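/- **Setting.** For $R\in SO(3)$ let $U_R=R\,U_I\subset S^2$, where $U_I=S^2\setminus\{\mathbf N,\mathbf S\}$ is the sphere without the poles $(0,0,\pm1)$, and let $(\theta_R,\phi_R)$ be the coordinates on $U_R$ obtained by rotating by $R$ the standard spherical coordinates $(\theta,\phi)$ of $U_I$. For $s\in\mathbb Z$ and a smooth function $h$ on $U_R$ put $$\partial_{sR}h=-(\sin\theta_R)^{s}\Big(\frac{\partial}{\partial\theta_R}+\frac{i}{\sin\theta_R}\frac{\partial}{\partial\phi_R}\Big)(\sin\theta_R)^{-s}h,\qquad \overline\partial_{sR}h=-(\sin\theta_R)^{-s}\Big(\frac{\partial}{\partial\theta_R}-\frac{i}{\sin\theta_R}\frac{\partial}{\partial\phi_R}\Big)(\sin\theta_R)^{s}h .$$ A spin $s$ function $f$ is given by its local expressions $f_R$ on $U_R$ $(R\in SO(3))$; the spin-raising and spin-lowering operators are $(\partial f)_R=\partial_{sR}f_R$ (of spin $s+1$) and $(\overline\partial f)_R=\overline\partial_{sR}f_R$ (of spin $s-1$). An ordinary function $F$ on $S^2$ is the spin $0$ function with $F_R=F|_{U_R}$. For $n\ge 0$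 let $$\partial^{[n]}_R=\partial_{n-1,R}\circ\cdots\circ\partial_{0,R},\qquad \overline\partial^{[n]}_R=\overline\partial_{-(n-1),R}\circ\cdots\circ\overline\partial_{0,R},$$ so that $(\partial^nF)_R=\partial^{[n]}_RF$ and $(\overline\partial^nF)_R=\overline\partial^{[n]}_RF$. For integers $l\ge0$, $-l\le m\le l$, let $Y_{lm}$ be the smooth function on $S^2$ given on $U_I$ by $$Y_{lm}(\theta,\phi)=e^{im\phi}(-1)^{m^-}\frac{a_{lm}}{l!}\sin^{2l}(\theta/2)\sum_r\binom{l}{r}\binom{l}{r-m}(-1)^{l-r}\cot^{2r-m}(\theta/2),\qquad a_{lm}=\Big[\tfrac{(l+m)!\,(l-m)!\,(2l+1)}{4\pi}\Big]^{1/2},$$ where $m^-=\max(-m,0)$ and binomial coefficients with negative lower entry are $0$. For $|s|\le l$ let $${}_sY_{lm}=\Big[\tfrac{(l-s)!}{(l+s)!}\Big]^{1/2}\partial^sY_{lm}\ (s\ge0),\qquad {}_sY_{lm}=\Big[\tfrac{(l+s)!}{(l-s)!}\Big]^{1/2}(-\overline\partial)^{-s}Y_{lm}\ (s\le0),$$ and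 define the spin $s$ projection kernel by $$K^{ls}_{R',R}(x,y)=\sum_{m=-l}^{l}{}_sY_{lmR'}(x)\,\overline{{}_sY_{lmR}(y)}\qquad(x\in U_{R'},\ y\in U_R).$$ For $s=0$ this does not depend on $R',R$, and gives the scalar kernel $K^{l0}(x,y)=\sum_{m=-l}^{l}Y_{lm}(x)\overline{Y_{lm}(y)}$ on $S^2\times S^2$. **Theorem.** Let $l\ge0$ and $s$ be integers with $|s|\le l$, let $R,R'\in SO(3)$, $x\in U_{R'}$ and $y\in U_R$. If $s>0$, then $$K^{ls}_{R',R}(x,y)=\frac{(l-s)!}{(l+s)!}\,\partial^{[s]}_{R',x}\,\overline\partial^{[s]}_{R,y}\,K^{l0}(x,y),$$ while if $s<0$, then $$K^{ls}_{R',R}(x,y)=\frac{(l+s)!}{(l-s)!}\,\overline\partial^{[-s]}_{R',x}\,\partial^{[-s]}_{R,y}\,K^{l0}(x,y).$$ Here $\partial^{[s]}_{R',x}$ means $\partial^{[s]}_{R'}$ applied in the variable $x$, and so on. -/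

import Mathlib

open Real Complex
open scoped ComplexConjugate

noncomputable section

namespace SpinSphere

/-! ## The sphere, rotations, spherical coordinates -/

/-- The unit sphere `S²` in Euclidean `ℝ³`. -/
abbrev S2 : Type := Metric.sphere (0 : EuclideanSpace ℝ (Fin 3)) 1

/-- The rotation group `SO(3)`. -/
abbrev SO3 : Type := Matrix.specialOrthogonalGroup (Fin 3) ℝ

/-- A vector of `ℝ³` with `a² + b² + c² = 1`, as a point of the sphere. -/
def mkS2 (a b c : ℝ) (h : a ^ 2 + b ^ 2 + c ^ 2 = 1) : S2 :=
  ⟨!₂[a, b, c], by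
    simp [EuclideanSpace.norm_eq, Fin.sum_univ_three, h]⟩

theorem S2.sq_add (p : S2) : p.1 0 ^ 2 + p.1 1 ^ 2 + p.1 2 ^ 2 = 1 := by
  have h : ‖p.1‖ = 1 := by simp
  have h2 := EuclideanSpace.real_norm_sq_eq p.1
  rw [h, Fin.sum_univ_three] at h2
  linarith

theorem norm_mulVec (R : SO3) (v : EuclideanSpace ℝ (Fin 3)) :
    ‖WithLp.toLp 2 (R.1.mulVec v.ofLp)‖ = ‖v‖ := by
  have hR : R.1.transpose * R.1 = 1 := by
    have h := (Matrix.mem_specialOrthogonalGroup_iff.1 R.2).1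
    exact (Matrix.mem_orthogonalGroup_iff' (Fin 3) ℝ).1 h
  have h1 : ∀ w : EuclideanSpace ℝ (Fin 3), ‖w‖ ^ 2 = w.ofLp ⬝ᵥ w.ofLp := by
    intro w
    rw [EuclideanSpace.real_norm_sq_eq]
    simp [dotProduct, sq]
  have h2 : ‖WithLp.toLp 2 (R.1.mulVec v.ofLp)‖ ^ 2 = ‖v‖ ^ 2 := by
    rw [h1, h1]
    simp only
    rw [Matrix.dotProduct_mulVec, Matrix.vecMul_mulVec, hR, Matrix.vecMul_one]
  exact (sq_eq_sq₀ (norm_nonneg _) (norm_nonneg _)).1 h2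

/-- The action `p ↦ R p` of a rotation on the sphere. -/
def rot (R : SO3) (p : S2) : S2 :=
  ⟨WithLp.toLp 2 (R.1.mulVec p.1.ofLp), by
    have h : ‖p.1‖ = 1 := by simp
    simp [norm_mulVec, h]⟩

/-- The north pole `(0, 0, 1)`. -/
def north : S2 := mkS2 0 0 1 (by norm_num)

/-- The south pole `(0, 0, -1)`. -/
def south : S2 := mkS2 0 0 (-1) (by norm_num)

/-- The chart domain `U_I`: the sphere without its poles. -/
def chartI : Set S2 := {north, south}ᶜ

/-- The rotated chart domain `U_R = R U_I`. -/
def chart (R : SO3) : Set S2 := rot R '' chartI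

/-- The point with spherical coordinates `(θ, φ)`. -/
def sph (θ φ : ℝ) : S2 :=
  mkS2 (Real.sin θ * Real.cos φ) (Real.sin θ * Real.sin φ) (Real.cos θ) (by
    nlinarith [Real.sin_sq_add_cos_sq θ, Real.sin_sq_add_cos_sq φ,
      mul_comm (Real.sin θ ^ 2) (Real.cos φ ^ 2)])

/-- The polar angle `θ ∈ [0, π]` of a point. -/
def theta (p : S2) : ℝ := Real.arccos (p.1 2)

/-- The azimuth `φ` of a point (a representative in `(-π, π]`). -/
def phi (p : S2) : ℝ := Complex.arg ((p.1 0 : ℂ) + (p.1 1 : ℂ) * I)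

/-- `(theta p, phi p)` are spherical coordinates of `p`. -/
theorem sph_theta_phi (p : S2) : sph (theta p) (phi p) = p := by
  have h := p.sq_add
  have hz1 : -1 ≤ p.1 2 := by nlinarith [sq_nonneg (p.1 0), sq_nonneg (p.1 1)]
  have hz2 : p.1 2 ≤ 1 := by nlinarith [sq_nonneg (p.1 0), sq_nonneg (p.1 1)]
  have hs : Real.sin (theta p) = ‖(p.1 0 : ℂ) + (p.1 1 : ℂ) * I‖ := by
    rw [theta, Real.sin_arccos, Complex.norm_add_mul_I]
    congr 1
    linarith
  apply Subtype.ext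
  ext i
  fin_cases i
  · simp only [sph, mkS2, hs, phi]
    simp
  · simp only [sph, mkS2, hs, phi]
    simp
  · simp [sph, mkS2, theta, Real.cos_arccos hz1 hz2]

/-! ## The spin-raising and spin-lowering operators -/

/-- The operator `∂_{sI}` on functions on `U_I`: in spherical coordinates
`-(sin θ)^s (∂/∂θ + (i / sin θ) ∂/∂φ) (sin θ)^{-s}`. -/
def ethI (s : ℤ) (h : S2 → ℂ) (p : S2) : ℂ :=
  -((Real.sin (theta p) : ℂ) ^ s) *
    (deriv (fun t : ℝ => (Real.sin t : ℂ) ^ (-s) * h (sph t (phi p))) (theta p) +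
      I / (Real.sin (theta p) : ℂ) *
        deriv (fun u : ℝ => (Real.sin (theta p) : ℂ) ^ (-s) * h (sph (theta p) u)) (phi p))

/-- The operator `∂̄_{sI}` on functions on `U_I`: in spherical coordinates
`-(sin θ)^{-s} (∂/∂θ - (i / sin θ) ∂/∂φ) (sin θ)^s`. -/
def ethBarI (s : ℤ) (h : S2 → ℂ) (p : S2) : ℂ :=
  -((Real.sin (theta p) : ℂ) ^ (-s)) *
    (deriv (fun t : ℝ => (Real.sin t : ℂ) ^ s * h (sph t (phi p))) (theta p) -
      I / (Real.sin (theta p) : ℂ) *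
        deriv (fun u : ℝ => (Real.sin (theta p) : ℂ) ^ s * h (sph (theta p) u)) (phi p))

/-- The operator `∂_{sR} h = [∂_{sI} (h ∘ R)] ∘ R⁻¹` on functions on `U_R`, i.e. `∂_{sI}` written
in the rotated coordinates `(θ_R, φ_R)`. -/
def ethR (s : ℤ) (R : SO3) (h : S2 → ℂ) (p : S2) : ℂ :=
  ethI s (fun q => h (rot R q)) (rot R⁻¹ p)

/-- The operator `∂̄_{sR} h = [∂̄_{sI} (h ∘ R)] ∘ R⁻¹` on functions on `U_R`. -/
def ethBarR (s : ℤ) (R : SO3) (h : S2 → ℂ) (p : S2) : ℂ :=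
  ethBarI s (fun q => h (rot R q)) (rot R⁻¹ p)

/-- `∂^{[n]}_R = ∂_{n-1,R} ∘ ⋯ ∘ ∂_{0,R}`, acting on ordinary functions (spin `0`). -/
def ethIter (R : SO3) : ℕ → (S2 → ℂ) → S2 → ℂ
  | 0, h => h
  | n + 1, h => ethR (n : ℤ) R (ethIter R n h)

/-- `∂̄^{[n]}_R = ∂̄_{-(n-1),R} ∘ ⋯ ∘ ∂̄_{0,R}`, acting on ordinary functions (spin `0`). -/
def ethBarIter (R : SO3) : ℕ → (S2 → ℂ) → S2 → ℂ
  | 0, h => h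
  | n + 1, h => ethBarR (-(n : ℤ)) R (ethBarIter R n h)

/-! ## Spin functions as families of local expressions

A spin `s` function is given by its local expressions `f = (f_R)_{R ∈ SO(3)}`; the values of `f_R`
off `U_R` carry no meaning. -/

/-- Families `(f_R)_{R ∈ SO(3)}` of local expressions. -/
abbrev LocalExpr : Type := SO3 → S2 → ℂ

/-- The spin-raising operator `∂` on spin `s` functions: `(∂ f)_R = ∂_{sR} f_R`. -/
def eth (s : ℤ) (f : LocalExpr) : LocalExpr := fun R => ethR s R (f R)

/-- The spin-lowering operator `∂̄` on spin `s` functions: `(∂̄ f)_R = ∂̄_{sR} f_R`. -/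
def ethBar (s : ℤ) (f : LocalExpr) : LocalExpr := fun R => ethBarR s R (f R)

/-- An ordinary function on the sphere as a spin `0` function. -/
def ofFun (F : S2 → ℂ) : LocalExpr := fun _ => F

/-- `∂^n F`, a spin `n` function, for an ordinary function `F`. -/
def ethPow (F : S2 → ℂ) : ℕ → LocalExpr
  | 0 => ofFun F
  | n + 1 => eth (n : ℤ) (ethPow F n)

/-- `(-∂̄)^n F`, a spin `-n` function, for an ordinary function `F`. -/
def negEthBarPow (F : S2 → ℂ) : ℕ → LocalExpr
  | 0 => ofFun F
  | n + 1 => -ethBar (-(n : ℤ)) (negEthBarPow F n)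

/-- `(∂^n F)_R = ∂^{[n]}_R F`. -/
theorem ethPow_apply (F : S2 → ℂ) (R : SO3) (n : ℕ) : ethPow F n R = ethIter R n F := by
  induction n with
  | zero => rfl
  | succ n ih => simp only [ethPow, eth, ethIter, ih]

/-! ## Spherical harmonics -/

/-- `k!` for an integer `k` (used only for `k ≥ 0`), as a real number. -/
def zfact (k : ℤ) : ℝ := (k.toNat.factorial : ℝ)

/-- `a_{lm} = [(l+m)! (l-m)! (2l+1) / (4π)]^{1/2}`. -/
def aCoeff (l : ℕ) (m : ℤ) : ℝ :=
  √(zfact (l + m) * zfact (l - m) * (2 * l + 1) / (4 * π))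

/-- The standard spherical harmonic `Y_{lm}`, `-l ≤ m ≤ l`, as a polynomial in the Cartesian
coordinates of the point; with `m⁺ = max m 0`, `m⁻ = max (-m) 0` and `w = x + i y` it is
`(-1)^{m⁻} (a_{lm} / l!) ∑_r C(l, r) C(l, r-m) (-1)^{l-r}
  (w/2)^{m⁺} (w̄/2)^{m⁻} ((1+z)/2)^{r-m⁺} ((1-z)/2)^{l-r-m⁻}`,
`r` running over the integers for which both binomial coefficients are nonzero.
See `sphY_sph` for the usual form in spherical coordinates. -/
def sphY (l : ℕ) (m : ℤ) (p : S2) : ℂ :=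
  (-1 : ℂ) ^ (-m).toNat * ((aCoeff l m / (l.factorial : ℝ) : ℝ) : ℂ) *
    ∑ r ∈ Finset.Icc m.toNat (l - (-m).toNat),
      (l.choose r : ℂ) * (l.choose ((r : ℤ) - m).toNat : ℂ) * (-1 : ℂ) ^ (l - r) *
        (((p.1 0 : ℂ) + (p.1 1 : ℂ) * I) / 2) ^ m.toNat *
        (((p.1 0 : ℂ) - (p.1 1 : ℂ) * I) / 2) ^ (-m).toNat *
        ((1 + (p.1 2 : ℂ)) / 2) ^ (r - m.toNat) *
        ((1 - (p.1 2 : ℂ)) / 2) ^ (l - r - (-m).toNat)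

/-- In spherical coordinates on `U_I`,
`Y_{lm} = e^{imφ} (-1)^{m⁻} (a_{lm} / l!) sin^{2l}(θ/2)
  ∑_r C(l, r) C(l, r-m) (-1)^{l-r} cot^{2r-m}(θ/2)`. -/
theorem sphY_sph (l : ℕ) (m : ℤ) (hm : |m| ≤ l) (θ φ : ℝ) (h0 : 0 < θ) (hπ : θ < π) :
    sphY l m (sph θ φ) =
      Complex.exp (I * m * φ) * (-1 : ℂ) ^ (-m).toNat * ((aCoeff l m / (l.factorial : ℝ) : ℝ) : ℂ) *
        (Real.sin (θ / 2) : ℂ) ^ (2 * l) *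
        ∑ r ∈ Finset.range (l + 1),
          (l.choose r : ℂ) *
            (if 0 ≤ (r : ℤ) - m then (l.choose ((r : ℤ) - m).toNat : ℂ) else 0) *
            (-1 : ℂ) ^ (l - r) * (Real.cot (θ / 2) : ℂ) ^ (2 * (r : ℤ) - m) := by
  have hsin : (0 : ℝ) < Real.sin (θ / 2) := Real.sin_pos_of_pos_of_lt_pi (by linarith) (by linarith)
  have hcos : (0 : ℝ) < Real.cos (θ / 2) :=
    Real.cos_pos_of_mem_Ioo ⟨by linarith, by linarith⟩
  set a : ℝ := Real.sin (θ / 2) with ha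
  set c : ℝ := Real.cos (θ / 2) with hc
  have ha0 : (a : ℂ) ≠ 0 := by exact_mod_cast hsin.ne'
  have hc0 : (c : ℂ) ≠ 0 := by exact_mod_cast hcos.ne'
  have hac : a ^ 2 + c ^ 2 = 1 := Real.sin_sq_add_cos_sq _
  have hst : Real.sin θ = 2 * a * c := by
    rw [ha, hc, ← Real.sin_two_mul]; congr 1; ring
  have hct : Real.cos θ = 2 * c ^ 2 - 1 := by
    rw [hc, ← Real.cos_two_mul]; congr 1; ring
  have hcot : Real.cot (θ / 2) = c / a := Real.cot_eq_cos_div_sin _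
  have e0 : (sph θ φ).1 0 = Real.sin θ * Real.cos φ := by simp [sph, mkS2]
  have e1 : (sph θ φ).1 1 = Real.sin θ * Real.sin φ := by simp [sph, mkS2]
  have e2 : (sph θ φ).1 2 = Real.cos θ := by simp [sph, mkS2]
  have w1 : (((sph θ φ).1 0 : ℂ) + ((sph θ φ).1 1 : ℂ) * I) / 2 =
      a * c * Complex.exp (I * φ) := by
    rw [e0, e1, hst, mul_comm I, Complex.exp_mul_I]; push_cast; ring
  have w2 : (((sph θ φ).1 0 : ℂ) - ((sph θ φ).1 1 : ℂ) * I) / 2 =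
      a * c * Complex.exp (-(I * φ)) := by
    rw [e0, e1, hst, mul_comm I, ← neg_mul, Complex.exp_mul_I, Complex.cos_neg, Complex.sin_neg]
    push_cast; ring
  have z1 : (1 + ((sph θ φ).1 2 : ℂ)) / 2 = (c : ℂ) ^ 2 := by
    rw [e2, hct]; push_cast; ring
  have z2 : (1 - ((sph θ φ).1 2 : ℂ)) / 2 = (a : ℂ) ^ 2 := by
    have : (a : ℂ) ^ 2 = 1 - (c : ℂ) ^ 2 := by
      rw [eq_sub_iff_add_eq]; exact_mod_cast hac
    rw [e2, hct, this]; push_cast; ring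
  rw [sphY, w1, w2, z1, z2, hcot]
  have hsub : Finset.Icc m.toNat (l - (-m).toNat) ⊆ Finset.range (l + 1) := by
    intro r hr; simp only [Finset.mem_Icc, Finset.mem_range] at *; omega
  rw [Finset.mul_sum, Finset.mul_sum, ← Finset.sum_subset hsub]
  · refine Finset.sum_congr rfl fun r hr => ?_
    rw [Finset.mem_Icc] at hr
    have hr0 : 0 ≤ (r : ℤ) - m := by omega
    rw [if_pos hr0]
    obtain ⟨n, rfl | rfl⟩ := m.eq_nat_or_neg
    · obtain ⟨k, rfl⟩ : ∃ k, r = n + k := ⟨r - n, by simp at hr; omega⟩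
      obtain ⟨j, rfl⟩ : ∃ j, l = n + k + j := ⟨l - (n + k), by simp at hr; omega⟩
      have t1 : (-(n : ℤ)).toNat = 0 := by omega
      have t2 : (2 * ((n + k : ℕ) : ℤ) - (n : ℤ)) = ((n + 2 * k : ℕ) : ℤ) := by push_cast; ring
      have x1 : Complex.exp (I * ((n : ℤ) : ℂ) * φ) = Complex.exp (I * φ) ^ n := by
        rw [← Complex.exp_nat_mul]; congr 1; push_cast; ring
      have d1 : n + k - n = k := by omega
      have d2 : n + k + j - (n + k) = j := by omega
      simp only [t1, t2, x1, zpow_natCast, Int.toNat_natCast, d1, d2, Nat.sub_zero,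
        div_pow, Complex.ofReal_div]
      push_cast
      field_simp
      ring
    · obtain ⟨k, rfl⟩ : ∃ k, l = r + n + k := ⟨l - (r + n), by
        have := abs_le.1 hm; simp at hr; omega⟩
      have t1 : (-(n : ℤ)).toNat = 0 := by omega
      have t2 : (2 * (r : ℤ) - (-(n : ℤ))) = ((n + 2 * r : ℕ) : ℤ) := by push_cast; ring
      have x1 : Complex.exp (I * ((-(n : ℤ) : ℤ) : ℂ) * φ) = Complex.exp (-(I * φ)) ^ n := by
        rw [← Complex.exp_nat_mul]; congr 1; push_cast; ring
      have d2 : r + n + k - r = n + k := by omega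
      have d3 : n + k - n = k := by omega
      simp only [t1, t2, x1, zpow_natCast, Int.toNat_natCast, d2, neg_neg, d3, Nat.sub_zero,
        div_pow, Complex.ofReal_div]
      push_cast
      field_simp
      ring
  · intro r hr hr'
    rw [Finset.mem_Icc] at hr'
    rw [Finset.mem_range] at hr
    split_ifs with h
    · rw [Nat.choose_eq_zero_of_lt (n := l) (k := ((r : ℤ) - m).toNat) (by
        have := abs_le.1 hm; omega)]
      simp
    · simp

/-- The spin `s` spherical harmonic `_sY_{lm}`, for `|s| ≤ l`, with its local expressions:
`[(l-s)!/(l+s)!]^{1/2} ∂^s Y_{lm}` if `s ≥ 0`, and `[(l+s)!/(l-s)!]^{1/2} (-∂̄)^{-s} Y_{lm}` if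
`s ≤ 0`. -/
def spinY (l : ℕ) (s m : ℤ) : LocalExpr :=
  if 0 ≤ s then
    fun R x => (√(zfact (l - s) / zfact (l + s)) : ℂ) * ethPow (sphY l m) s.toNat R x
  else
    fun R x => (√(zfact (l + s) / zfact (l - s)) : ℂ) * negEthBarPow (sphY l m) (-s).toNat R x

/-! ## The projection kernels -/

/-- The kernel `K^{ls}` of the projection onto the span of `_sY_{lm}`, `-l ≤ m ≤ l`:
`K^{ls}_{R',R}(x, y) = ∑_m _sY_{lmR'}(x) conj (_sY_{lmR}(y))`. -/
def spinKernel (l : ℕ) (s : ℤ) (R' R : SO3) (x y : S2) : ℂ :=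
  ∑ m ∈ Finset.Icc (-(l : ℤ)) l, spinY l s m R' x * conj (spinY l s m R y)

/-- The scalar kernel `K^{l0}(x, y)`, a function on `S² × S²`. -/
def scalarKernel (l : ℕ) (x y : S2) : ℂ :=
  ∑ m ∈ Finset.Icc (-(l : ℤ)) l, sphY l m x * conj (sphY l m y)

/-- For `s = 0` the local expressions of `K^{ls}` are all equal to the scalar kernel. -/
theorem spinKernel_zero (l : ℕ) (R' R : SO3) (x y : S2) :
    spinKernel l 0 R' R x y = scalarKernel l x y := by
  have h : zfact (l : ℤ) / zfact (l : ℤ) = 1 := div_self (by simp [zfact, Nat.factorial_ne_zero])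
  simp [spinKernel, scalarKernel, spinY, ethPow, ofFun, h]

end SpinSphere

end

namespace SpinSphere

open Set

/-! ## Spherical coordinates -/

/-! The kernel is a finite sum of products of a function of `x` and the conjugate of a function of
`y`, so operators in the two variables act factor by factor. Two facts carry this. The iterated
operators are linear on finite sums of smooth functions (`ethIter_sum`, `ethBarIter_sum`). Lowering
is raising conjugated, `∂̄_s h = conj (∂_{-s} (conj h))` (`ethBarIter_eq_conj`), so lowering `conj
Y_{lm}` in `y` gives the conjugate of raising `Y_{lm}`. The two square roots in a product of spin
harmonics multiply to the factorial quotient, and for `s < 0` the two signs `(-1)^{-s}` cancel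
(`spinKernel_of_pos`, `spinKernel_of_neg`).

Linearity is where analysis enters: `deriv` is additive only on differentiable functions, so
smoothness off the poles must survive each application (`SmoothI.ethI`). -/

theorem theta_sph {t : ℝ} (ht : t ∈ Ioo 0 π) (u : ℝ) : theta (sph t u) = t := by
  simp [theta, sph, mkS2, Real.arccos_cos ht.1.le ht.2.le]

theorem cos_sin_phi_sph {t : ℝ} (ht : t ∈ Ioo 0 π) (u : ℝ) :
    Real.cos (phi (sph t u)) = Real.cos u ∧ Real.sin (phi (sph t u)) = Real.sin u := by
  have h := sph_theta_phi (sph t u)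
  rw [theta_sph ht] at h
  have hs : Real.sin t ≠ 0 := (Real.sin_pos_of_mem_Ioo ht).ne'
  have h0 := congrArg (fun p : S2 => p.1 0) h
  have h1 := congrArg (fun p : S2 => p.1 1) h
  simp only [sph, mkS2] at h0 h1
  exact ⟨mul_left_cancel₀ hs (by simpa [sph, mkS2] using h0),
    mul_left_cancel₀ hs (by simpa [sph, mkS2] using h1)⟩

theorem sph_eq_of_cos_sin (t : ℝ) {u v : ℝ} (hc : Real.cos u = Real.cos v)
    (hs : Real.sin u = Real.sin v) : sph t u = sph t v := by
  simp only [sph, hc, hs]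

theorem theta_mem_Ioo {p : S2} (hp : p ∈ chartI) : theta p ∈ Ioo 0 π := by
  have h := sph_theta_phi p
  refine ⟨(Real.arccos_nonneg _).lt_of_ne' fun h0 => hp ?_,
    (Real.arccos_le_pi _).lt_of_ne fun h0 => hp ?_⟩
  · left
    rw [← h, show theta p = 0 from h0]
    simp [sph, north]
  · right
    rw [← h, show theta p = π from h0]
    simp [sph, south]

/-- The azimuth `phi (sph t u)` may differ from `u` by a multiple of `2π`; `sph` is periodic, so the
branch does not affect the derivatives. Any coordinates of the point may then be used. -/
theorem ethI_sph (s : ℤ) (h : S2 → ℂ) {t : ℝ} (ht : t ∈ Ioo 0 π) (u : ℝ) :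
    ethI s h (sph t u) = -((Real.sin t : ℂ) ^ s) *
      (deriv (fun t' : ℝ => (Real.sin t' : ℂ) ^ (-s) * h (sph t' u)) t +
        I / (Real.sin t : ℂ) *
          deriv (fun u' : ℝ => (Real.sin t : ℂ) ^ (-s) * h (sph t u')) u) := by
  obtain ⟨hc, hs⟩ := cos_sin_phi_sph ht u
  have shift : ∀ v, sph t (phi (sph t u) + v) = sph t (u + v) := fun v =>
    sph_eq_of_cos_sin t (by rw [Real.cos_add, Real.cos_add, hc, hs])
      (by rw [Real.sin_add, Real.sin_add, hc, hs])
  -- Moving both base points to `0` leaves functions of the increment alone, which `shift`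
  -- identifies.
  have e : ∀ (f : ℝ → ℂ) (a : ℝ), deriv f a = deriv (fun v => f (a + v)) 0 := fun f a => by
    rw [deriv_comp_const_add, add_zero]
  rw [ethI, theta_sph ht, e _ (phi _), e _ u]
  simp only [shift, sph_eq_of_cos_sin _ hc hs]

/-! ## Smooth functions on the coordinate domain -/

/-- The coordinate domain of `chartI`. -/
def coordDomain : Set (ℝ × ℝ) := Ioo 0 π ×ˢ univ

theorem isOpen_coordDomain : IsOpen coordDomain := isOpen_Ioo.prod isOpen_univ

/-- Smoothness in spherical coordinates on `chartI`. -/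
def SmoothI (h : S2 → ℂ) : Prop :=
  ContDiffOn ℝ (⊤ : ℕ∞) (fun a : ℝ × ℝ => h (sph a.1 a.2)) coordDomain

theorem contDiffOn_sin_zpow (s : ℤ) :
    ContDiffOn ℝ (⊤ : ℕ∞) (fun a : ℝ × ℝ => (Real.sin a.1 : ℂ) ^ s) coordDomain := by
  have hsin : ContDiff ℝ (⊤ : ℕ∞) (fun a : ℝ × ℝ => (Real.sin a.1 : ℂ)) :=
    Complex.ofRealCLM.contDiff.comp (Real.contDiff_sin.comp contDiff_fst)
  obtain ⟨n, rfl | rfl⟩ := s.eq_nat_or_neg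
  · simpa only [zpow_natCast] using (hsin.pow n).contDiffOn
  · simp only [zpow_neg, zpow_natCast]
    refine (hsin.pow n).contDiffOn.inv fun a ha => pow_ne_zero _ ?_
    exact_mod_cast (Real.sin_pos_of_mem_Ioo ha.1).ne'

theorem SmoothI.weighted {h : S2 → ℂ} (hh : SmoothI h) (s : ℤ) :
    ContDiffOn ℝ (⊤ : ℕ∞) (fun a : ℝ × ℝ => (Real.sin a.1 : ℂ) ^ s * h (sph a.1 a.2))
      coordDomain :=
  (contDiffOn_sin_zpow s).mul hh

theorem SmoothI.differentiableAt_weighted {h : S2 → ℂ} (hh : SmoothI h) (s : ℤ) {a : ℝ × ℝ}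
    (ha : a ∈ coordDomain) :
    DifferentiableAt ℝ (fun a : ℝ × ℝ => (Real.sin a.1 : ℂ) ^ s * h (sph a.1 a.2)) a :=
  ((hh.weighted s).contDiffAt (isOpen_coordDomain.mem_nhds ha)).differentiableAt (by simp)

theorem hasDerivAt_fst_slice {f : ℝ × ℝ → ℂ} {t u : ℝ} (hf : DifferentiableAt ℝ f (t, u)) :
    HasDerivAt (fun t' => f (t', u)) (fderiv ℝ f (t, u) (1, 0)) t :=
  hf.hasFDerivAt.comp_hasDerivAt t ((hasDerivAt_id t).prodMk (hasDerivAt_const t u))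

theorem hasDerivAt_snd_slice {f : ℝ × ℝ → ℂ} {t u : ℝ} (hf : DifferentiableAt ℝ f (t, u)) :
    HasDerivAt (fun u' => f (t, u')) (fderiv ℝ f (t, u) (0, 1)) u :=
  hf.hasFDerivAt.comp_hasDerivAt u ((hasDerivAt_const u t).prodMk (hasDerivAt_id u))

/-- Partial derivatives become values of one `fderiv`, whose smoothness in the base point is
available; `1 / sin` becomes a `zpow`, covered by `contDiffOn_sin_zpow`. -/
theorem SmoothI.ethI_sph_eq_fderiv {h : S2 → ℂ} (hh : SmoothI h) (s : ℤ) {a : ℝ × ℝ}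
    (ha : a ∈ coordDomain) :
    ethI s h (sph a.1 a.2) = -((Real.sin a.1 : ℂ) ^ s) *
      (fderiv ℝ (fun a : ℝ × ℝ => (Real.sin a.1 : ℂ) ^ (-s) * h (sph a.1 a.2)) a (1, 0) +
        I * (Real.sin a.1 : ℂ) ^ (-1 : ℤ) *
          fderiv ℝ (fun a : ℝ × ℝ => (Real.sin a.1 : ℂ) ^ (-s) * h (sph a.1 a.2)) a (0, 1)) := by
  have hd := hh.differentiableAt_weighted (-s) ha
  rw [ethI_sph s h ha.1, zpow_neg_one, ← div_eq_mul_inv]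
  congr 2
  · exact (hasDerivAt_fst_slice hd).deriv
  · exact congrArg _ (hasDerivAt_snd_slice hd).deriv

theorem SmoothI.ethI {h : S2 → ℂ} (hh : SmoothI h) (s : ℤ) : SmoothI (ethI s h) := by
  have hf := (hh.weighted (-s)).fderiv_of_isOpen (m := (⊤ : ℕ∞)) isOpen_coordDomain (by simp)
  refine ContDiffOn.congr ?_ fun a ha => hh.ethI_sph_eq_fderiv s ha
  exact (contDiffOn_sin_zpow s).neg.mul ((hf.clm_apply contDiffOn_const).add
    ((contDiffOn_const.mul (contDiffOn_sin_zpow (-1))).mul (hf.clm_apply contDiffOn_const)))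

/-! ## Linearity of the iterated operator in the unrotated chart -/

/-- The coordinate domain is open, so agreement there gives equal derivatives. The induction in
`ethIterI_sum` needs this, as its hypothesis says nothing at the poles. -/
theorem ethI_congr (s : ℤ) {f g : S2 → ℂ}
    (hfg : ∀ t ∈ Ioo 0 π, ∀ u, f (sph t u) = g (sph t u)) {t : ℝ} (ht : t ∈ Ioo 0 π) (u : ℝ) :
    ethI s f (sph t u) = ethI s g (sph t u) := by
  rw [ethI_sph s f ht, ethI_sph s g ht]
  have e : (fun t' : ℝ => (Real.sin t' : ℂ) ^ (-s) * f (sph t' u)) =ᶠ[nhds t]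
      fun t' : ℝ => (Real.sin t' : ℂ) ^ (-s) * g (sph t' u) := by
    filter_upwards [isOpen_Ioo.mem_nhds ht] with t' ht'
    rw [hfg t' ht']
  rw [e.deriv_eq]
  simp only [hfg t ht]

theorem ethI_sum {ι : Type*} (S : Finset ι) (c : ι → ℂ) (f : ι → S2 → ℂ)
    (hf : ∀ i ∈ S, SmoothI (f i)) (s : ℤ) {t : ℝ} (ht : t ∈ Ioo 0 π) (u : ℝ) :
    ethI s (fun q => ∑ i ∈ S, c i * f i q) (sph t u) = ∑ i ∈ S, c i * ethI s (f i) (sph t u) := by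
  have ha : (t, u) ∈ coordDomain := ⟨ht, mem_univ _⟩
  have h1 : HasDerivAt (fun t' : ℝ => (Real.sin t' : ℂ) ^ (-s) * ∑ i ∈ S, c i * f i (sph t' u))
      (∑ i ∈ S, c i * fderiv ℝ
        (fun a : ℝ × ℝ => (Real.sin a.1 : ℂ) ^ (-s) * f i (sph a.1 a.2)) (t, u) (1, 0)) t := by
    refine (HasDerivAt.fun_sum fun i hi => (hasDerivAt_fst_slice
      ((hf i hi).differentiableAt_weighted (-s) ha)).const_mul (c i)).congr_of_eventuallyEq ?_
    refine Filter.Eventually.of_forall fun t' => ?_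
    simp only [Finset.mul_sum]
    exact Finset.sum_congr rfl fun i _ => mul_left_comm _ _ _
  have h2 : HasDerivAt (fun u' : ℝ => (Real.sin t : ℂ) ^ (-s) * ∑ i ∈ S, c i * f i (sph t u'))
      (∑ i ∈ S, c i * fderiv ℝ
        (fun a : ℝ × ℝ => (Real.sin a.1 : ℂ) ^ (-s) * f i (sph a.1 a.2)) (t, u) (0, 1)) u := by
    refine (HasDerivAt.fun_sum fun i hi => (hasDerivAt_snd_slice
      ((hf i hi).differentiableAt_weighted (-s) ha)).const_mul (c i)).congr_of_eventuallyEq ?_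
    refine Filter.Eventually.of_forall fun t' => ?_
    simp only [Finset.mul_sum]
    exact Finset.sum_congr rfl fun i _ => mul_left_comm _ _ _
  rw [ethI_sph s _ ht, h1.deriv, h2.deriv, Finset.mul_sum, ← Finset.sum_add_distrib,
    Finset.mul_sum]
  refine Finset.sum_congr rfl fun i hi => ?_
  rw [(hf i hi).ethI_sph_eq_fderiv s ha, zpow_neg_one]
  ring

/-- The iterated spin-raising operator in the unrotated chart. -/
noncomputable def ethIterI : ℕ → (S2 → ℂ) → S2 → ℂ
  | 0, h => h
  | n + 1, h => ethI (n : ℤ) (ethIterI n h)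

theorem SmoothI.ethIterI {h : S2 → ℂ} (hh : SmoothI h) : ∀ n, SmoothI (ethIterI n h)
  | 0 => hh
  | n + 1 => (hh.ethIterI n).ethI n

theorem ethIterI_sum {ι : Type*} (S : Finset ι) (c : ι → ℂ) (f : ι → S2 → ℂ)
    (hf : ∀ i ∈ S, SmoothI (f i)) (n : ℕ) : ∀ t ∈ Ioo 0 π, ∀ u,
    ethIterI n (fun q => ∑ i ∈ S, c i * f i q) (sph t u) =
      ∑ i ∈ S, c i * ethIterI n (f i) (sph t u) := by
  induction n with
  | zero => intro t _ u; rfl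
  | succ n ih =>
    intro t ht u
    exact (ethI_congr n ih ht u).trans
      (ethI_sum S c _ (fun i hi => (hf i hi).ethIterI n) n ht u)

/-! ## Rotated charts -/

theorem rot_inv_rot (R : SO3) (p : S2) : rot R⁻¹ (rot R p) = p := by
  apply Subtype.ext
  have h : (R⁻¹).1 * R.1 = 1 := congrArg Subtype.val (inv_mul_cancel R)
  simp [rot, Matrix.mulVec_mulVec, h]

/-- Each step conjugates by `R`, and the adjacent factors `R⁻¹` and `R` cancel, so a single rotation
remains. -/
theorem ethIter_eq_ethIterI (R : SO3) (h : S2 → ℂ) (n : ℕ) (p : S2) :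
    ethIter R n h (rot R p) = ethIterI n (fun q => h (rot R q)) p := by
  induction n generalizing p with
  | zero => rfl
  | succ n ih => simp only [ethIter, ethR, ethIterI, rot_inv_rot, ih]

theorem ethIter_sum {ι : Type*} (S : Finset ι) (c : ι → ℂ) (f : ι → S2 → ℂ) (R : SO3)
    (hf : ∀ i ∈ S, SmoothI (fun q => f i (rot R q))) (n : ℕ) {x : S2} (hx : x ∈ chart R) :
    ethIter R n (fun q => ∑ i ∈ S, c i * f i q) x = ∑ i ∈ S, c i * ethIter R n (f i) x := by
  obtain ⟨p, hp, rfl⟩ := hx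
  simp only [ethIter_eq_ethIterI]
  rw [← sph_theta_phi p]
  exact ethIterI_sum S c _ hf n _ (theta_mem_Ioo hp) _

/-! ## Complex conjugation -/

theorem deriv_conj (f : ℝ → ℂ) (a : ℝ) :
    deriv (fun t => conj (f t)) a = conj (deriv f a) := deriv.star

/-- Conjugation fixes the real weights, flips the sign of `i` and commutes with `deriv`, even where
the derivative is a default value; hence no smoothness is required. -/
theorem ethBarI_eq_conj (s : ℤ) (h : S2 → ℂ) (p : S2) :
    ethBarI s h p = conj (ethI (-s) (fun q => conj (h q)) p) := by
  simp only [ethI, ethBarI, map_mul, map_neg, map_add, ← deriv_conj, map_zpow₀, map_div₀,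
    Complex.conj_ofReal, Complex.conj_conj, neg_neg, Complex.conj_I]
  ring

theorem ethBarIter_eq_conj (R : SO3) (h : S2 → ℂ) (n : ℕ) (p : S2) :
    ethBarIter R n h p = conj (ethIter R n (fun q => conj (h q)) p) := by
  induction n generalizing p with
  | zero => simp [ethBarIter, ethIter]
  | succ n ih =>
    simp only [ethBarIter, ethIter, ethBarR, ethR, ethBarI_eq_conj, neg_neg, ih,
      Complex.conj_conj]

theorem ethBarIter_sum {ι : Type*} (S : Finset ι) (c : ι → ℂ) (f : ι → S2 → ℂ) (R : SO3)
    (hf : ∀ i ∈ S, SmoothI (fun q => conj (f i (rot R q)))) (n : ℕ) {x : S2}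
    (hx : x ∈ chart R) :
    ethBarIter R n (fun q => ∑ i ∈ S, c i * f i q) x =
      ∑ i ∈ S, c i * ethBarIter R n (f i) x := by
  simp only [ethBarIter_eq_conj, map_sum, map_mul]
  rw [ethIter_sum S (fun i => conj (c i)) (fun i q => conj (f i q)) R hf n hx]
  simp

/-! ## Spherical harmonics -/

theorem SmoothI.conj {h : S2 → ℂ} (hh : SmoothI h) : SmoothI (fun q => conj (h q)) :=
  Complex.conjCLE.contDiff.comp_contDiffOn hh

theorem contDiff_rot_sph (R : SO3) (i : Fin 3) :
    ContDiff ℝ (⊤ : ℕ∞) (fun a : ℝ × ℝ => (((rot R (sph a.1 a.2)).1 i : ℝ) : ℂ)) := by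
  have e : ∀ a : ℝ × ℝ, (rot R (sph a.1 a.2)).1 i = R.1 i 0 * (Real.sin a.1 * Real.cos a.2) +
      R.1 i 1 * (Real.sin a.1 * Real.sin a.2) + R.1 i 2 * Real.cos a.1 := fun a => by
    simp [rot, sph, mkS2, Matrix.mulVec, dotProduct, Fin.sum_univ_three]
  simp only [e]
  have h : ContDiff ℝ (⊤ : ℕ∞) fun a : ℝ × ℝ => R.1 i 0 * (Real.sin a.1 * Real.cos a.2) +
      R.1 i 1 * (Real.sin a.1 * Real.sin a.2) + R.1 i 2 * Real.cos a.1 := by fun_prop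
  exact Complex.ofRealCLM.contDiff.comp h

theorem smoothI_sphY_rot (l : ℕ) (m : ℤ) (R : SO3) : SmoothI (fun q => sphY l m (rot R q)) := by
  have h := contDiff_rot_sph R
  have h0 := h 0
  have h1 := h 1
  have h2 := h 2
  apply ContDiff.contDiffOn
  simp only [sphY]
  refine contDiff_const.mul (ContDiff.sum fun r _ => ?_)
  exact ((((contDiff_const.mul (((h0.add (h1.mul contDiff_const)).div_const _).pow _)).mul
    (((h0.sub (h1.mul contDiff_const)).div_const _).pow _))).mul
    (((contDiff_const.add h2).div_const _).pow _)).mul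
    (((contDiff_const.sub h2).div_const _).pow _)

theorem negEthBarPow_apply (F : S2 → ℂ) (R : SO3) (n : ℕ) (p : S2) :
    negEthBarPow F n R p = (-1) ^ n * ethBarIter R n F p := by
  induction n generalizing p with
  | zero => simp [negEthBarPow, ethBarIter, ofFun]
  | succ n ih =>
    have hs : ∀ (c : ℂ) (f : S2 → ℂ) (s : ℤ) (q : S2),
        ethBarI s (fun q => c * f q) q = c * ethBarI s f q := by
      intro c f s q
      -- A constant from a field leaves `deriv` without differentiability, so `F` can be arbitrary.
      simp only [ethBarI, mul_left_comm _ c, deriv_const_mul_field]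
      ring
    have e : negEthBarPow F n R = fun q => (-1) ^ n * ethBarIter R n F q := funext ih
    have e' : negEthBarPow F (n + 1) R p = -ethBarR (-(n : ℤ)) R (negEthBarPow F n R) p := rfl
    rw [e', e, ethBarR, hs, pow_succ]
    simp only [ethBarIter, ethBarR]
    ring

theorem ofReal_sqrt_mul_self {a : ℝ} (ha : 0 ≤ a) : (√a : ℂ) * (√a : ℂ) = (a : ℂ) := by
  rw [← Complex.ofReal_mul, Real.mul_self_sqrt ha]

theorem zfact_nonneg (k : ℤ) : 0 ≤ zfact k := Nat.cast_nonneg _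

theorem spinKernel_of_pos (l : ℕ) {s : ℤ} (hs : 0 < s) (R' R : SO3) (x y : S2) :
    spinKernel l s R' R x y = ((zfact (l - s) / zfact (l + s) : ℝ) : ℂ) *
      ∑ m ∈ Finset.Icc (-(l : ℤ)) l, ethIter R' s.toNat (sphY l m) x *
        conj (ethIter R s.toNat (sphY l m) y) := by
  rw [spinKernel, Finset.mul_sum]
  refine Finset.sum_congr rfl fun m _ => ?_
  simp only [spinY, if_pos hs.le, ethPow_apply, map_mul, Complex.conj_ofReal]
  rw [mul_mul_mul_comm, ofReal_sqrt_mul_self (div_nonneg (zfact_nonneg _) (zfact_nonneg _))]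

theorem spinKernel_of_neg (l : ℕ) {s : ℤ} (hs : s < 0) (R' R : SO3) (x y : S2) :
    spinKernel l s R' R x y = ((zfact (l + s) / zfact (l - s) : ℝ) : ℂ) *
      ∑ m ∈ Finset.Icc (-(l : ℤ)) l, ethBarIter R' (-s).toNat (sphY l m) x *
        conj (ethBarIter R (-s).toNat (sphY l m) y) := by
  rw [spinKernel, Finset.mul_sum]
  refine Finset.sum_congr rfl fun m _ => ?_
  simp only [spinY, if_neg hs.not_ge, negEthBarPow_apply, map_mul, Complex.conj_ofReal, map_pow,
    map_neg, map_one]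
  have h1 : ((-1 : ℂ) ^ (-s).toNat) * (-1) ^ (-s).toNat = 1 := by
    rw [← mul_pow]; simp
  rw [mul_mul_mul_comm, ofReal_sqrt_mul_self (div_nonneg (zfact_nonneg _) (zfact_nonneg _)),
    mul_mul_mul_comm, h1, one_mul]

end SpinSphere

open SpinSphere in
theorem theorem5p3 (l : ℕ) (s : ℤ) (hs : |s| ≤ (l : ℤ)) (R' R : SO3) (x y : S2)
    (hx : x ∈ chart R') (hy : y ∈ chart R) :
    (0 < s →
      spinKernel l s R' R x y =
        ((zfact (l - s) / zfact (l + s) : ℝ) : ℂ) *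
          ethIter R' s.toNat (fun x' => ethBarIter R s.toNat (fun y' => scalarKernel l x' y') y) x) ∧
    (s < 0 →
      spinKernel l s R' R x y =
        ((zfact (l + s) / zfact (l - s) : ℝ) : ℂ) *
          ethBarIter R' (-s).toNat
            (fun x' => ethIter R (-s).toNat (fun y' => scalarKernel l x' y') y) x) := by
  have hsm : ∀ (Q : SO3) (m : ℤ), SmoothI (fun q => sphY l m (rot Q q)) :=
    fun Q m => smoothI_sphY_rot l m Q
  refine ⟨fun h => ?_, fun h => ?_⟩
  -- For fixed `y` the factors `sphY l m x'` are constant coefficients. The identity holds for every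
  -- `x'`, poles of the chart included, so it can be substituted under the outer operator, where the
  -- roles of the factors swap.
  · have inner : ∀ x', ethBarIter R s.toNat (fun y' => scalarKernel l x' y') y =
        ∑ m ∈ Finset.Icc (-(l : ℤ)) l, conj (ethIter R s.toNat (sphY l m) y) * sphY l m x' := by
      intro x'
      simp only [scalarKernel]
      rw [ethBarIter_sum _ (fun m => sphY l m x') (fun m q => conj (sphY l m q)) R
        (fun m _ => by simpa only [Complex.conj_conj] using hsm R m) _ hy]
      simp only [ethBarIter_eq_conj, Complex.conj_conj, mul_comm]
    simp only [inner]
    rw [spinKernel_of_pos l h, ethIter_sum _ _ _ R' (fun m _ => hsm R' m) _ hx]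
    simp only [mul_comm]
  · have inner : ∀ x', ethIter R (-s).toNat (fun y' => scalarKernel l x' y') y =
        ∑ m ∈ Finset.Icc (-(l : ℤ)) l,
          conj (ethBarIter R (-s).toNat (sphY l m) y) * sphY l m x' := by
      intro x'
      simp only [scalarKernel]
      rw [ethIter_sum _ (fun m => sphY l m x') (fun m q => conj (sphY l m q)) R
        (fun m _ => (hsm R m).conj) _ hy]
      simp only [ethBarIter_eq_conj, Complex.conj_conj, mul_comm]
    simp only [inner]
    rw [spinKernel_of_neg l h, ethBarIter_sum _ _ _ R' (fun m _ => (hsm R' m).conj) _ hx]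
    simp only [mul_comm]
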